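/- **Definitions.** Let $f: X\to\Sigma_O$ with $X\subseteq\{0,\dots,\sigma-1\}^n$. For $1\le i\le n$ and $0\le p<\sigma$ let $O_{i,p}$ be the diagonal $|X|\times|X|$ matrix with $O_{i,p}[x,x]=e^{2\pi \mathbf i\,p x_i/\sigma}$, and for $z\in\Sigma_O$ let $F_z$ be the diagonal projector onto the inputs $x$ with $f(x)=z$. For a Hermitian $|X|\times|X|$ matrix $\Gamma$ write $\Gamma_{i,p}=O_{i,p}^*\,\Gamma\,O_{i,p}$; $\|\cdot\|$ is the spectral norm. For $\eta<1$ and $\zeta>0$, the multiplicative adversary bound is $$\mathrm{MADV}_{\eta,4\zeta}(f)=\sup_{\Gamma,\lambda}\frac{\log(\zeta^2\lambda)}{\log\big(\max_{i,p}\|\Gamma_{i,p}\Gamma^{-1}\|\big)}\in[-\infty,\infty],$$ where $\Gamma$ ranges over the positive definite matrices with smallest eigenvalue $1$ and $\lambda$ over the reals with $1<\lambda\le\|\Gamma\|$ such that $\|F_z\Pi_{\mathrm{bad}}\|^2\le\eta$ for every $z\in\Sigma_O$; here $\Pi_{\mathrm{bad}}$ is the orthogonal projector onto the sum of the eigenspaces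 of $\Gamma$ with eigenvalues smaller than $\lambda$. For $1\le t\le n$, $\mathrm{Threshold}_{t,n}$ is the function on $\{x\in\{0,1\}^n: |x|\in\{t-1,t\}\}$ given by $\mathrm{Threshold}_{t,n}(x)=|x|-t+1\in\{0,1\}$, where $|x|$ is the Hamming weight. **Theorem.** $\mathrm{MADV}_{1/2,4\zeta}(\mathrm{Threshold}_{t,n})=\Omega(\zeta^2\sqrt{tn})$. That is, there is an absolute constant $c>0$ such that for all integers $n,t$ with $1\le t\le n/2$ and all real $\zeta>0$, $$\mathrm{MADV}_{1/2,4\zeta}(\mathrm{Threshold}_{t,n})\ \ge\ c\,\zeta^2\sqrt{tn}.$$ -/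

import Mathlib

noncomputable section

namespace QuantumAdversary

open scoped Matrix.Norms.L2Operator ComplexOrder

/-! ### The multiplicative adversary bound of a function `f : X → O`, `X ⊆ {0, …, σ-1}ⁿ`.
Matrices are indexed by the inputs `x ∈ X`; `‖·‖` is the spectral norm. -/

variable {n σ : ℕ} {X : Finset (Fin n → Fin σ)} {O : Type*} [DecidableEq O]

/-- The diagonal unitary `O_{i,p}` with entries `exp (2 π 𝐢 p xᵢ / σ)`: the query operator on
the block in which position `i` is queried with phase multiplier `p`. -/
def queryMatrix (X : Finset (Fin n → Fin σ)) (i : Fin n) (p : Fin σ) : Matrix X X ℂ :=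
  Matrix.diagonal fun x =>
    Complex.exp (2 * Real.pi * Complex.I / (σ : ℂ) * ((p : ℕ) : ℂ) * ((x.1 i : ℕ) : ℂ))

/-- `Γ_{i,p} = O_{i,p}^* Γ O_{i,p}`. -/
def queried (Γ : Matrix X X ℂ) (i : Fin n) (p : Fin σ) : Matrix X X ℂ :=
  (queryMatrix X i p).conjTranspose * Γ * queryMatrix X i p

/-- `max_{i,p} ‖Γ_{i,p} Γ⁻¹‖` (a maximum over a finite set). -/
def queryRatio (Γ : Matrix X X ℂ) : ℝ :=
  ⨆ ip : Fin n × Fin σ, ‖queried Γ ip.1 ip.2 * Γ⁻¹‖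

/-- The diagonal projector `F_z` onto the inputs `x` with `f x = z`. -/
def outputProj (f : X → O) (z : O) : Matrix X X ℂ :=
  Matrix.diagonal fun x => if f x = z then 1 else 0

/-- The sum of the eigenspaces of `Γ` for the (real) eigenvalues smaller than `lam`. -/
def badSubspace (Γ : Matrix X X ℂ) (lam : ℝ) : Submodule ℂ (EuclideanSpace ℂ X) :=
  ⨆ μ : {μ : ℝ // μ < lam}, Module.End.eigenspace (Matrix.toEuclideanLin Γ) ((μ.1 : ℝ) : ℂ)

/-- The matrix `Π_bad` of the orthogonal projection onto `badSubspace Γ lam`. -/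
def badProj (Γ : Matrix X X ℂ) (lam : ℝ) : Matrix X X ℂ :=
  (Matrix.toEuclideanCLM (n := X) (𝕜 := ℂ)).symm (badSubspace Γ lam).starProjection

/-- The conditions on an adversary matrix `Γ` and a number `lam` in the multiplicative adversary
method: `Γ` is positive definite with smallest eigenvalue `1`, `1 < lam ≤ ‖Γ‖`, and
`‖F_z Π_bad‖² ≤ η` for every output letter `z`. -/
structure IsMultAdversary (f : X → O) (η : ℝ) (Γ : Matrix X X ℂ) (lam : ℝ) : Prop where
  posDef : Γ.PosDef
  isLeast_eigenvalue :
    IsLeast {μ : ℝ | Module.End.HasEigenvalue (Matrix.toEuclideanLin Γ) (μ : ℂ)} 1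
  one_lt : 1 < lam
  le_norm : lam ≤ ‖Γ‖
  bad_le : ∀ z : O, ‖outputProj f z * badProj Γ lam‖ ^ 2 ≤ η

/-- The multiplicative adversary bound `MADV_{η,ξ}(f)`, where `ξ = 4 ζ`: the largest value,
as a supremum of extended reals, of
`log (ζ² lam) / log (max_{i,p} ‖Γ_{i,p} / Γ‖)` over all admissible `Γ` and `lam`.
For `η < 1` the denominator is positive: otherwise `Γ` would commute with all `O_{i,p}`, hence
be diagonal, and `‖F_z Π_bad‖ = 1` for some `z`. -/
def MADV (f : X → O) (η ξ : ℝ) : EReal :=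
  ⨆ (Γ : Matrix X X ℂ) (lam : ℝ) (_ : IsMultAdversary f η Γ lam),
    ((Real.log ((ξ / 4) ^ 2 * lam) / Real.log (queryRatio Γ) : ℝ) : EReal)

/-! ### The threshold function -/

/-- The Hamming weight `|x|` of a bit string. -/
def weight (x : Fin n → Fin 2) : ℕ := ∑ i, (x i : ℕ)

/-- The bit strings of length `n` of weight `t - 1` or `t`. -/
def thresholdInputs (t n : ℕ) : Finset (Fin n → Fin 2) :=
  {x | weight x + 1 = t ∨ weight x = t}

theorem threshold_lt_two {t n : ℕ} (x : thresholdInputs t n) : weight x.1 + 1 - t < 2 := by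
  have h := x.2
  simp only [thresholdInputs, Finset.mem_filter, Finset.mem_univ, true_and] at h
  omega

/-- `Threshold_{t,n} (x) = |x| - t + 1 ∈ {0, 1}` on the strings of weight `t - 1` or `t`. -/
def threshold (t n : ℕ) (x : thresholdInputs t n) : Fin 2 :=
  ⟨weight x.1 + 1 - t, threshold_lt_two x⟩

end QuantumAdversary

end

/-!
The multiplicative adversary matrix is obtained by linearizing an additive one. On the inputs of
weight `t - 1` and `t`, let `A` be the adjacency matrix of the graph joining strings that differ in
one bit. Its top eigenvalue is `N = √(t (n + 1 - t))`, with an explicit positive eigenvector `v`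
that is constant on each layer. Put `Γ = 1 + κ (N - A)` and `lam = 1 + κ N`.

* The positive eigenvector gives `A ≤ N` (`posSemidef_smul_one_sub_of_pos_eigenvector`), so `Γ ≥ 1`,
  and `Γ v = v`.
* The graph is bipartite between the two outputs, so the diagonal output sign `P` anticommutes with
  `A` and reflects the spectrum of `Γ` about `lam`. Hence `P` maps the bad subspace, spanned by
  the eigenvectors of `Γ` below `lam`, into its orthogonal complement; as `F_z = (1 ± P) / 2`,
  this gives `‖F_z w‖² = ‖w‖² / 2` for every bad vector `w` (`sq_norm_outputProj_mul_badProj_le`).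
* A query to bit `i` changes `A` by twice the matching of the flips of bit `i`, a matrix of norm at
  most `1`. Since `‖Γ⁻¹‖ ≤ 1`, the query ratio is at most `1 + 2 κ`. It is larger than `1`, because
  `Γ⁻¹ v = v` and some query lowers the quadratic form of `A` at `v`.

With `κ N = e / ζ²` the numerator `log (ζ² lam) = log (ζ² + e)` is at least `1` and the denominator
is positive and at most `2 κ`, so the quotient is at least `1 / (2 κ) = ζ² N / (2 e)`, which is of
order `ζ² √(t n)` for `t ≤ n / 2`.
-/

namespace QuantumAdversary

open Matrix

open scoped Matrix.Norms.L2Operator ComplexOrder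

/-! ### Hermitian matrices above the identity -/

section Spectral

variable {V : Type*} [Fintype V] [DecidableEq V]

theorem sq_norm_le_re_inner_of_posSemidef_sub_one {Γ : Matrix V V ℂ} (h : (Γ - 1).PosSemidef)
    (w : EuclideanSpace ℂ V) : ‖w‖ ^ 2 ≤ (inner ℂ w (toEuclideanLin Γ w)).re := by
  have h1 := (isPositive_toEuclideanLin_iff.2 h).re_inner_nonneg_right w
  have h2 : toEuclideanLin (1 : Matrix V V ℂ) w = w := by
    ext i; simp
  rw [map_sub, LinearMap.sub_apply, h2, inner_sub_right, map_sub, inner_self_eq_norm_sq] at h1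
  simpa using h1

omit [Fintype V] in
theorem posDef_of_posSemidef_sub_one {Γ : Matrix V V ℂ} (h : (Γ - 1).PosSemidef) : Γ.PosDef := by
  simpa using PosDef.posSemidef_add h PosDef.one

theorem norm_inv_le_one_of_posSemidef_sub_one {Γ : Matrix V V ℂ} (h : (Γ - 1).PosSemidef) :
    ‖Γ⁻¹‖ ≤ 1 := by
  have hu : IsUnit Γ.det := (isUnit_iff_isUnit_det Γ).1 (posDef_of_posSemidef_sub_one h).isUnit
  rw [cstar_norm_def]
  refine ContinuousLinearMap.opNorm_le_bound _ zero_le_one fun u => ?_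
  set w := toEuclideanCLM (n := V) (𝕜 := ℂ) Γ⁻¹ u with hw
  have hΓ : toEuclideanLin Γ w = u := by
    ext i
    simp [hw, mul_nonsing_inv _ hu]
  have h1 := sq_norm_le_re_inner_of_posSemidef_sub_one h w
  rw [hΓ] at h1
  have h2 : (inner ℂ w u).re ≤ ‖w‖ * ‖u‖ := re_inner_le_norm (𝕜 := ℂ) w u
  rw [one_mul]
  by_contra! hlt
  nlinarith [norm_nonneg u]

/-- The ground state representation: if a symmetric matrix `a` with nonnegative entries has a
positive eigenvector `v` for `N`, then substituting `x = v y` turns the quadratic form of `N - a`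
into `½ ∑ vᵢ aᵢⱼ vⱼ |yᵢ - yⱼ|²`. -/
theorem posSemidef_smul_one_sub_of_pos_eigenvector {A : Matrix V V ℂ} {a : V → V → ℝ}
    (hA : ∀ i j, A i j = a i j) (hsymm : ∀ i j, a i j = a j i) (hnonneg : ∀ i j, 0 ≤ a i j)
    {v : V → ℝ} (hv : ∀ i, 0 < v i) {N : ℝ} (hN : ∀ i, ∑ j, a i j * v j = N * v i) :
    ((N : ℂ) • (1 : Matrix V V ℂ) - A).PosSemidef := by
  refine PosSemidef.of_dotProduct_mulVec_nonneg ?_ fun x => ?_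
  · ext i j
    by_cases hij : i = j
    · subst hij; simp [hA]
    · simp [hA, hsymm i j, one_apply_ne hij, one_apply_ne (Ne.symm hij)]
  set y : V → ℂ := fun i => x i / v i with hy
  have hx : ∀ i, x i = v i * y i := fun i => by
    have : (v i : ℂ) ≠ 0 := by exact_mod_cast (hv i).ne'
    simp only [hy]; field_simp
  have hNc : ∀ i, (N : ℂ) * v i = ∑ j, (a i j : ℂ) * v j := fun i => by
    exact_mod_cast (hN i).symm
  have key : star x ⬝ᵥ (((N : ℂ) • (1 : Matrix V V ℂ) - A) *ᵥ x)
      = ∑ i, ∑ j, ((v i * a i j * v j : ℝ) : ℂ) * (star (y i) * (y i - y j)) := by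
    simp only [dotProduct]
    refine Finset.sum_congr rfl fun i _ => ?_
    have : (((N : ℂ) • (1 : Matrix V V ℂ) - A) *ᵥ x) i
        = ∑ j, (a i j : ℂ) * v j * (y i - y j) := by
      rw [sub_mulVec, Pi.sub_apply, smul_mulVec, one_mulVec, Pi.smul_apply, smul_eq_mul, hx i,
        ← mul_assoc, hNc i, Finset.sum_mul]
      simp only [mulVec, dotProduct, hA, hx]
      rw [← Finset.sum_sub_distrib]
      exact Finset.sum_congr rfl fun j _ => by ring
    rw [this, Finset.mul_sum]
    refine Finset.sum_congr rfl fun j _ => ?_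
    simp only [Pi.star_apply, hx i, star_mul', RCLike.star_def, Complex.conj_ofReal]
    push_cast
    ring
  have key2 : star x ⬝ᵥ (((N : ℂ) • (1 : Matrix V V ℂ) - A) *ᵥ x)
      = ∑ i, ∑ j, ((v i * a i j * v j : ℝ) : ℂ) * (star (y j) * (y j - y i)) := by
    rw [key, Finset.sum_comm]
    refine Finset.sum_congr rfl fun i _ => Finset.sum_congr rfl fun j _ => ?_
    rw [hsymm j i]
    congr 2
    ring
  have key3 : star x ⬝ᵥ (((N : ℂ) • (1 : Matrix V V ℂ) - A) *ᵥ x)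
      = ((1 / 2 * ∑ i, ∑ j, v i * a i j * v j * Complex.normSq (y i - y j) : ℝ) : ℂ) := by
    have : ∀ z : ℂ, z = 1 / 2 * (z + z) := fun z => by ring
    rw [this (star x ⬝ᵥ _)]
    nth_rewrite 2 [key2]
    rw [key, ← Finset.sum_add_distrib]
    push_cast
    congr 1
    refine Finset.sum_congr rfl fun i _ => ?_
    rw [← Finset.sum_add_distrib]
    refine Finset.sum_congr rfl fun j _ => ?_
    rw [Complex.normSq_eq_conj_mul_self, map_sub]
    simp only [RCLike.star_def]
    ring
  rw [key3]
  have : 0 ≤ 1 / 2 * ∑ i, ∑ j, v i * a i j * v j * Complex.normSq (y i - y j) := by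
    refine mul_nonneg (by norm_num) (Finset.sum_nonneg fun i _ => Finset.sum_nonneg fun j _ => ?_)
    exact mul_nonneg (mul_nonneg (mul_nonneg (hv i).le (hnonneg i j)) (hv j).le)
      (Complex.normSq_nonneg _)
  exact_mod_cast this

theorem abs_le_norm_of_mulVec_eq_smul {A : Matrix V V ℂ} {v : V → ℂ} (hv : v ≠ 0) {μ : ℝ}
    (h : A *ᵥ v = (μ : ℂ) • v) : |μ| ≤ ‖A‖ := by
  have h1 := (toEuclideanCLM (n := V) (𝕜 := ℂ) A).le_opNorm (WithLp.toLp 2 v)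
  rw [toEuclideanCLM_toLp, h, WithLp.toLp_smul, norm_smul, ← cstar_norm_def] at h1
  have h2 : 0 < ‖WithLp.toLp 2 v‖ := norm_pos_iff.2 (by simpa using hv)
  simpa using le_of_mul_le_mul_right h1 h2

end Spectral

/-! ### From a top eigenvector to the multiplicative adversary bound -/

section Method

variable {n σ : ℕ} {X : Finset (Fin n → Fin σ)}

/-- The diagonal matrix with sign `1` at the inputs with output `0` and `-1` at those with
output `1`. -/
noncomputable def outputSign (f : X → Fin 2) : Matrix X X ℂ :=
  diagonal fun x => if f x = 0 then 1 else -1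

theorem outputProj_eq (f : X → Fin 2) (z : Fin 2) :
    outputProj f z = (1 / 2 : ℂ) • (1 + (if z = 0 then (1 : ℂ) else -1) • outputSign f) := by
  ext x y
  by_cases hxy : x = y
  · subst hxy
    have h2 : ∀ a : Fin 2, a = 0 ∨ a = 1 := by decide
    rcases h2 (f x) with h | h <;> rcases h2 z with h' | h' <;>
      simp [outputProj, outputSign, h, h'] <;> norm_num
  · split_ifs <;> simp [outputProj, outputSign, hxy]

theorem outputProj_isHermitian {O : Type*} [DecidableEq O] (f : X → O) (z : O) :
    (outputProj f z).IsHermitian :=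
  isHermitian_diagonal_of_self_adjoint _ <| funext fun x => by
    by_cases h : f x = z <;> simp [h]

theorem outputProj_mul_self {O : Type*} [DecidableEq O] (f : X → O) (z : O) :
    outputProj f z * outputProj f z = outputProj f z := by
  simp [outputProj]

/-- `P` reflects the spectrum of `Γ` about `lam`, so it maps eigenvectors with eigenvalue below
`lam` to eigenvectors with eigenvalue above `lam`, and those are orthogonal to `badSubspace`. -/
theorem inner_badSubspace_eq_zero {Γ P : Matrix X X ℂ} {lam : ℝ} (hΓ : Γ.IsHermitian)
    (hP : Γ * P = ((2 * lam : ℝ) : ℂ) • P - P * Γ) {w w' : EuclideanSpace ℂ X}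
    (hw : w ∈ badSubspace Γ lam) (hw' : w' ∈ badSubspace Γ lam) :
    inner ℂ w (toEuclideanLin P w') = 0 := by
  have hsym : (toEuclideanLin Γ).IsSymmetric := isSymmetric_toEuclideanLin_iff.2 hΓ
  refine Submodule.iSup_induction _ (motive := fun w => inner ℂ w (toEuclideanLin P w') = 0) hw
    (fun μ u hu => ?_) (by simp) (fun a b ha hb => by rw [inner_add_left, ha, hb, add_zero])
  refine Submodule.iSup_induction _ (motive := fun w' => inner ℂ u (toEuclideanLin P w') = 0) hw'
    (fun ν u' hu' => ?_) (by simp)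
    (fun a b ha hb => by rw [map_add, inner_add_right, ha, hb, add_zero])
  rw [Module.End.mem_eigenspace_iff] at hu hu'
  have hrefl : toEuclideanLin Γ (toEuclideanLin P u')
      = ((2 * lam - ν.1 : ℝ) : ℂ) • toEuclideanLin P u' := by
    have h1 : toEuclideanLin Γ (toEuclideanLin P u') = toEuclideanLin (Γ * P) u' := by
      ext i; simp
    have h2 : toEuclideanLin (P * Γ) u' = toEuclideanLin P (toEuclideanLin Γ u') := by
      ext i; simp
    rw [h1, hP, map_sub, map_smul, LinearMap.sub_apply, LinearMap.smul_apply, h2, hu', map_smul,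
      ← sub_smul]
    push_cast
    rfl
  have h := hsym u (toEuclideanLin P u')
  rw [hu, hrefl, inner_smul_left, inner_smul_right, Complex.conj_ofReal] at h
  have hne : (μ.1 : ℂ) - ((2 * lam - ν.1 : ℝ) : ℂ) ≠ 0 := by
    have : μ.1 - (2 * lam - ν.1) ≠ 0 := by linarith [μ.2, ν.2]
    exact_mod_cast this
  exact (mul_eq_zero.1 (by rw [sub_mul, h, sub_self])).resolve_left hne

/-- For `w` in the bad subspace, `F_z w = (w ± P w) / 2` with `P w` orthogonal to `w`, so that
`‖F_z w‖² = ⟪w, F_z w⟫ = ‖w‖² / 2`. -/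
theorem sq_norm_outputProj_mul_badProj_le {f : X → Fin 2} {Γ : Matrix X X ℂ} {lam : ℝ}
    (hΓ : Γ.IsHermitian)
    (hP : Γ * outputSign f = ((2 * lam : ℝ) : ℂ) • outputSign f - outputSign f * Γ) (z : Fin 2) :
    ‖outputProj f z * badProj Γ lam‖ ^ 2 ≤ 1 / 2 := by
  have key : ∀ w ∈ badSubspace Γ lam, ‖toEuclideanLin (outputProj f z) w‖ ^ 2 = 1 / 2 * ‖w‖ ^ 2 := by
    intro w hw
    have hsym : (toEuclideanLin (outputProj f z)).IsSymmetric :=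
      isSymmetric_toEuclideanLin_iff.2 (outputProj_isHermitian f z)
    have h1 : toEuclideanLin (outputProj f z) (toEuclideanLin (outputProj f z) w)
        = toEuclideanLin (outputProj f z) w := by
      conv_rhs => rw [← outputProj_mul_self]
      ext i; simp
    have h2 : toEuclideanLin (1 : Matrix X X ℂ) w = w := by
      ext i; simp
    rw [← inner_self_eq_norm_sq (𝕜 := ℂ), ← inner_self_eq_norm_sq (𝕜 := ℂ), hsym, h1, outputProj_eq,
      map_smul, map_add, map_smul, LinearMap.smul_apply, LinearMap.add_apply, LinearMap.smul_apply,
      h2, inner_smul_right, inner_add_right, inner_smul_right,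
      inner_badSubspace_eq_zero hΓ hP hw hw, mul_zero, add_zero]
    simp
  have hle : ‖outputProj f z * badProj Γ lam‖ ≤ √(1 / 2) := by
    rw [cstar_norm_def, map_mul]
    refine ContinuousLinearMap.opNorm_le_bound _ (Real.sqrt_nonneg _) fun w => ?_
    rw [mul_apply_eq_comp, badProj, StarAlgEquiv.apply_symm_apply]
    have h1 := key _ ((badSubspace Γ lam).starProjection_apply_mem w)
    have h2 : ‖(badSubspace Γ lam).starProjection w‖ ≤ ‖w‖ :=
      (badSubspace Γ lam).norm_starProjection_apply_le w
    refine abs_le_of_sq_le_sq' ?_ (by positivity) |>.2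
    rw [mul_pow, Real.sq_sqrt (by norm_num)]
    calc _ = _ := h1
      _ ≤ _ := by gcongr
  calc _ ≤ √(1 / 2) ^ 2 := by gcongr
    _ = _ := Real.sq_sqrt (by norm_num)

/-- The matrix `1 + κ (N - A)`, which turns the top eigenvalue `N` of a Hermitian matrix `A` into
the smallest eigenvalue `1`. -/
noncomputable def shiftedMatrix (A : Matrix X X ℂ) (N κ : ℝ) : Matrix X X ℂ :=
  ((1 + κ * N : ℝ) : ℂ) • 1 - (κ : ℂ) • A

theorem shiftedMatrix_mulVec {A : Matrix X X ℂ} {N κ μ : ℝ} {v : X → ℂ}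
    (h : A *ᵥ v = (μ : ℂ) • v) :
    shiftedMatrix A N κ *ᵥ v = ((1 + κ * (N - μ) : ℝ) : ℂ) • v := by
  rw [shiftedMatrix, sub_mulVec, smul_mulVec, smul_mulVec, h, one_mulVec, smul_smul, ← sub_smul]
  push_cast
  ring_nf

theorem shiftedMatrix_sub_one_posSemidef {A : Matrix X X ℂ} {N κ : ℝ} (hκ : 0 ≤ κ)
    (h : ((N : ℂ) • (1 : Matrix X X ℂ) - A).PosSemidef) : (shiftedMatrix A N κ - 1).PosSemidef := by
  have : shiftedMatrix A N κ - 1 = (κ : ℂ) • ((N : ℂ) • (1 : Matrix X X ℂ) - A) := by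
    rw [shiftedMatrix, smul_sub, smul_smul]
    push_cast
    rw [add_smul, one_smul]
    abel
  rw [this]
  exact h.smul (by exact_mod_cast hκ)

/-- The bound `lam ≤ ‖Γ‖` comes from the reflected vector `P v`, which has the `Γ`-eigenvalue
`1 + 2 κ N`. -/
theorem shiftedMatrix_isMultAdversary {f : X → Fin 2} {A : Matrix X X ℂ} {N κ : ℝ} (hN : 0 < N)
    (hκ : 0 < κ) (hpsd : ((N : ℂ) • (1 : Matrix X X ℂ) - A).PosSemidef)
    (hsign : A * outputSign f = -(outputSign f * A)) {v : X → ℂ} (hv0 : v ≠ 0)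
    (hv : A *ᵥ v = (N : ℂ) • v) :
    IsMultAdversary f (1 / 2) (shiftedMatrix A N κ) (1 + κ * N) := by
  have hκN : 0 < κ * N := mul_pos hκ hN
  have h1 := shiftedMatrix_sub_one_posSemidef hκ.le hpsd
  have hpd := posDef_of_posSemidef_sub_one h1
  refine ⟨hpd, ⟨?_, ?_⟩, by linarith, ?_, fun z => ?_⟩
  · refine Module.End.hasEigenvalue_of_hasEigenvector (x := WithLp.toLp 2 v)
      ⟨Module.End.mem_eigenspace_iff.2 ?_, by simpa using hv0⟩
    rw [toLpLin_toLp, toLin'_apply, shiftedMatrix_mulVec hv]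
    simp
  · rintro μ hμ
    obtain ⟨w, hw, hw0⟩ := hμ.exists_hasEigenvector
    rw [Module.End.mem_eigenspace_iff] at hw
    have h2 := sq_norm_le_re_inner_of_posSemidef_sub_one h1 w
    rw [hw, inner_smul_right, inner_self_eq_norm_sq_to_K] at h2
    have h3 : 0 < ‖w‖ ^ 2 := by positivity
    have h4 : ((μ : ℂ) * (‖w‖ : ℂ) ^ 2).re = μ * ‖w‖ ^ 2 := by
      norm_cast
    have h5 : ‖w‖ ^ 2 ≤ μ * ‖w‖ ^ 2 := h2.trans_eq h4
    exact le_of_mul_le_mul_right (by linarith) h3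
  · have hinv : outputSign f * outputSign f = 1 := by
      rw [outputSign, diagonal_mul_diagonal, ← diagonal_one]
      congr 1; ext x; split_ifs <;> simp
    have hPv : outputSign f *ᵥ v ≠ 0 := fun h => hv0 <| by
      rw [← one_mulVec v, ← hinv, ← mulVec_mulVec, h, mulVec_zero]
    have hAPv : A *ᵥ (outputSign f *ᵥ v) = ((-N : ℝ) : ℂ) • (outputSign f *ᵥ v) := by
      rw [mulVec_mulVec, hsign, neg_mulVec, ← mulVec_mulVec, hv, mulVec_smul]
      simp
    have h2 := abs_le_norm_of_mulVec_eq_smul hPv (shiftedMatrix_mulVec (N := N) (κ := κ) hAPv)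
    refine le_trans ?_ ((le_abs_self _).trans h2)
    nlinarith
  · refine sq_norm_outputProj_mul_badProj_le hpd.isHermitian ?_ z
    rw [shiftedMatrix, sub_mul, mul_sub, smul_mul_assoc, smul_mul_assoc, one_mul, hsign,
      mul_smul_comm, mul_smul_comm, mul_one]
    push_cast
    module

theorem queried_shiftedMatrix (A : Matrix X X ℂ) (N κ : ℝ) (i : Fin n) (p : Fin σ) :
    queried (shiftedMatrix A N κ) i p = shiftedMatrix A N κ + (κ : ℂ) • (A - queried A i p) := by
  have hU : (queryMatrix X i p)ᴴ * queryMatrix X i p = 1 := by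
    rw [queryMatrix, diagonal_conjTranspose, diagonal_mul_diagonal, ← diagonal_one]
    congr 1
    ext x
    rw [Pi.star_apply, RCLike.star_def, ← Complex.exp_conj, ← Complex.exp_add, ← Complex.exp_zero]
    congr 1
    simp only [map_mul, map_div₀, Complex.conj_ofReal, Complex.conj_I, map_natCast, map_ofNat]
    ring
  simp only [queried, shiftedMatrix, mul_sub, sub_mul, mul_smul_comm, smul_mul_assoc, mul_one, hU]
  module

theorem norm_le_queryRatio (Γ : Matrix X X ℂ) (i : Fin n) (p : Fin σ) :
    ‖queried Γ i p * Γ⁻¹‖ ≤ queryRatio Γ :=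
  le_ciSup (f := fun ip : Fin n × Fin σ => ‖queried Γ ip.1 ip.2 * Γ⁻¹‖)
    (Set.finite_range _).bddAbove (i, p)

theorem queryRatio_shiftedMatrix_le {A : Matrix X X ℂ} {N κ d : ℝ} (hκ : 0 ≤ κ) (hd : 0 ≤ d)
    (hpsd : ((N : ℂ) • (1 : Matrix X X ℂ) - A).PosSemidef)
    (hA : ∀ i p, ‖A - queried A i p‖ ≤ d) : queryRatio (shiftedMatrix A N κ) ≤ 1 + κ * d := by
  have h1 := shiftedMatrix_sub_one_posSemidef hκ hpsd
  have hu : IsUnit (shiftedMatrix A N κ).det :=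
    (isUnit_iff_isUnit_det _).1 (posDef_of_posSemidef_sub_one h1).isUnit
  refine Real.iSup_le (fun ip => ?_) (by positivity)
  rw [queried_shiftedMatrix, add_mul, mul_nonsing_inv _ hu]
  have hone : ‖(1 : Matrix X X ℂ)‖ ≤ 1 := by
    rw [← diagonal_one, l2_opNorm_diagonal, pi_norm_le_iff_of_nonneg zero_le_one]
    simp
  calc _ ≤ ‖(1 : Matrix X X ℂ)‖ + ‖(κ : ℂ) • (A - queried A ip.1 ip.2)‖
        * ‖(shiftedMatrix A N κ)⁻¹‖ := (norm_add_le _ _).trans (by gcongr; exact norm_mul_le _ _)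
    _ ≤ 1 + (κ * d) * 1 := by
        gcongr
        · rw [norm_smul, Complex.norm_real, Real.norm_of_nonneg hκ]
          exact mul_le_mul_of_nonneg_left (hA _ _) hκ
        · exact norm_inv_le_one_of_posSemidef_sub_one h1
    _ = _ := by ring

/-- A query that lowers the quadratic form of `A` at the top eigenvector `v` makes the
denominator of `MADV` nonzero, because `Γ⁻¹ v = v`. -/
theorem one_lt_queryRatio_shiftedMatrix {A : Matrix X X ℂ} {N κ : ℝ} (hκ : 0 < κ)
    (hpsd : ((N : ℂ) • (1 : Matrix X X ℂ) - A).PosSemidef) {v : X → ℂ}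
    (hv : A *ᵥ v = (N : ℂ) • v) {i : Fin n} {p : Fin σ}
    (hi : 0 < (star v ⬝ᵥ ((A - queried A i p) *ᵥ v)).re) :
    1 < queryRatio (shiftedMatrix A N κ) := by
  set Γ := shiftedMatrix A N κ with hΓ
  have h1 := shiftedMatrix_sub_one_posSemidef hκ.le hpsd
  have hu : IsUnit Γ.det := (isUnit_iff_isUnit_det _).1 (posDef_of_posSemidef_sub_one h1).isUnit
  have hΓv : Γ *ᵥ v = v := by
    rw [hΓ, shiftedMatrix_mulVec hv]; simp
  have hinv : Γ⁻¹ *ᵥ v = v := by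
    conv_lhs => rw [← hΓv]
    rw [mulVec_mulVec, nonsing_inv_mul _ hu, one_mulVec]
  refine lt_of_lt_of_le ?_ (norm_le_queryRatio Γ i p)
  by_contra! hle
  have hB : (queried Γ i p * Γ⁻¹) *ᵥ v = v + (κ : ℂ) • ((A - queried A i p) *ᵥ v) := by
    rw [← mulVec_mulVec, hinv, hΓ, queried_shiftedMatrix, add_mulVec, smul_mulVec, ← hΓ, hΓv]
  set w : EuclideanSpace ℂ X := WithLp.toLp 2 v with hw
  have h2 : (inner ℂ w (toEuclideanLin (queried Γ i p * Γ⁻¹) w)).re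
      = ‖w‖ ^ 2 + κ * (star v ⬝ᵥ ((A - queried A i p) *ᵥ v)).re := by
    have h3 : toEuclideanLin (queried Γ i p * Γ⁻¹) w
        = w + (κ : ℂ) • WithLp.toLp 2 ((A - queried A i p) *ᵥ v) := by
      rw [hw, toLpLin_toLp, toLin'_apply, hB]; rfl
    rw [h3, inner_add_right, inner_smul_right, inner_self_eq_norm_sq_to_K,
      EuclideanSpace.inner_eq_star_dotProduct, dotProduct_comm, Complex.add_re,
      Complex.re_ofReal_mul]
    congr 1
    norm_cast
  have h3 : (inner ℂ w (toEuclideanLin (queried Γ i p * Γ⁻¹) w)).re ≤ ‖w‖ * (1 * ‖w‖) := by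
    refine (re_inner_le_norm (𝕜 := ℂ) _ _).trans ?_
    gcongr
    exact ((toEuclideanCLM (n := X) (𝕜 := ℂ) (queried Γ i p * Γ⁻¹)).le_opNorm w).trans
      (by rw [← cstar_norm_def]; gcongr)
  have := mul_pos hκ hi
  nlinarith

/-- The multiplicative bound dominates the additive one: if `A` has top eigenvalue `N` and every
query changes `A` by at most `d` in norm, then `MADV` is at least of order `ζ² N / d`. -/
theorem le_MADV_of_top_eigenvector {f : X → Fin 2} {A : Matrix X X ℂ} {N d : ℝ}
    (hN : 0 < N) (hd : 0 < d) (hpsd : ((N : ℂ) • (1 : Matrix X X ℂ) - A).PosSemidef)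
    (hsign : A * outputSign f = -(outputSign f * A)) {v : X → ℂ} (hv0 : v ≠ 0)
    (hv : A *ᵥ v = (N : ℂ) • v) (hA : ∀ i p, ‖A - queried A i p‖ ≤ d)
    (hlt : ∃ i p, 0 < (star v ⬝ᵥ ((A - queried A i p) *ᵥ v)).re) {ζ : ℝ} (hζ : 0 < ζ) :
    ((ζ ^ 2 * N / (Real.exp 1 * d) : ℝ) : EReal) ≤ MADV f (1 / 2) (4 * ζ) := by
  obtain ⟨i, p, hi⟩ := hlt
  -- With this `κ`, `ζ² lam = ζ² + e`, so that the numerator of `MADV` is at least `1`.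
  set κ := Real.exp 1 / (ζ ^ 2 * N) with hκdef
  have he := Real.exp_pos 1
  have hκ : 0 < κ := by positivity
  have hadv := shiftedMatrix_isMultAdversary hN hκ hpsd hsign hv0 hv
  refine le_trans ?_ (le_iSup_of_le (shiftedMatrix A N κ) <| le_iSup_of_le (1 + κ * N) <|
    le_iSup_of_le hadv le_rfl)
  rw [EReal.coe_le_coe_iff]
  have hlow := one_lt_queryRatio_shiftedMatrix hκ hpsd hv hi
  have hup := queryRatio_shiftedMatrix_le hκ.le hd.le hpsd hA
  have hden : 0 < Real.log (queryRatio (shiftedMatrix A N κ)) := Real.log_pos hlow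
  have hden' : Real.log (queryRatio (shiftedMatrix A N κ)) ≤ κ * d := by
    have := Real.log_le_sub_one_of_pos (zero_lt_one.trans hlow)
    linarith
  have hval : (4 * ζ / 4) ^ 2 * (1 + κ * N) = ζ ^ 2 + Real.exp 1 := by
    rw [hκdef]; field_simp
  have hnum : 1 ≤ Real.log ((4 * ζ / 4) ^ 2 * (1 + κ * N)) := by
    rw [hval, Real.le_log_iff_exp_le (by positivity)]
    nlinarith
  calc ζ ^ 2 * N / (Real.exp 1 * d) = 1 / (κ * d) := by rw [hκdef]; field_simp
    _ ≤ _ := div_le_div₀ (by linarith) hnum hden hden'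

end Method

/-! ### The one-bit flip graph on two layers of the cube -/

section Threshold

variable {t n : ℕ}

/-- The string `x` with bit `i` flipped. -/
def flipBit (i : Fin n) (x : Fin n → Fin 2) : Fin n → Fin 2 := Function.update x i (x i + 1)

theorem flipBit_flipBit (i : Fin n) (x : Fin n → Fin 2) : flipBit i (flipBit i x) = x := by
  have h : ∀ a : Fin 2, a + 1 + 1 = a := by decide
  simp [flipBit, h]

theorem eq_flipBit_comm {i : Fin n} {x y : Fin n → Fin 2} : y = flipBit i x ↔ x = flipBit i y :=
  ⟨fun h => by rw [h, flipBit_flipBit], fun h => by rw [h, flipBit_flipBit]⟩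

theorem weight_flipBit_add (i : Fin n) (x : Fin n → Fin 2) :
    weight (flipBit i x) + x i = weight x + (x i + 1 : Fin 2) := by
  have h : ∀ y : Fin n → Fin 2, weight y = y i + ∑ j ∈ Finset.univ.erase i, (y j : ℕ) := fun y =>
    (Finset.add_sum_erase _ _ (Finset.mem_univ i)).symm
  have h2 : ∑ j ∈ Finset.univ.erase i, (flipBit i x j : ℕ)
      = ∑ j ∈ Finset.univ.erase i, (x j : ℕ) :=
    Finset.sum_congr rfl fun j hj => by
      rw [flipBit, Function.update_of_ne (Finset.ne_of_mem_erase hj)]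
  rw [h x, h (flipBit i x), h2]
  simp only [flipBit, Function.update_self]
  omega

theorem fin_two_cases (a : Fin 2) : a = 0 ∨ a = 1 := by
  revert a; decide

theorem weight_flipBit_of_eq_zero {i : Fin n} {x : Fin n → Fin 2} (h : x i = 0) :
    weight (flipBit i x) = weight x + 1 := by
  simpa [h] using weight_flipBit_add i x

theorem weight_flipBit_of_eq_one {i : Fin n} {x : Fin n → Fin 2} (h : x i = 1) :
    weight (flipBit i x) + 1 = weight x := by
  simpa [h] using weight_flipBit_add i x

theorem mem_thresholdInputs {x : Fin n → Fin 2} :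
    x ∈ thresholdInputs t n ↔ weight x + 1 = t ∨ weight x = t := by
  simp [thresholdInputs]

theorem threshold_eq_zero_iff (x : thresholdInputs t n) :
    threshold t n x = 0 ↔ weight x.1 + 1 = t := by
  have h := mem_thresholdInputs.1 x.2
  rw [threshold, Fin.ext_iff]
  simp only [Fin.val_zero]
  omega

/-- The adjacency matrix of the matching that pairs inputs differing in bit `i` only. -/
noncomputable def bitMatching (t n : ℕ) (i : Fin n) :
    Matrix (thresholdInputs t n) (thresholdInputs t n) ℂ :=
  of fun x y => if y.1 = flipBit i x.1 then 1 else 0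

/-- The adjacency matrix of the graph joining inputs that differ in exactly one bit. -/
noncomputable def flipGraph (t n : ℕ) : Matrix (thresholdInputs t n) (thresholdInputs t n) ℂ :=
  ∑ i, bitMatching t n i

theorem bitMatching_transpose (i : Fin n) : (bitMatching t n i)ᵀ = bitMatching t n i := by
  ext x y
  simp only [bitMatching, transpose_apply, of_apply]
  exact if_congr eq_flipBit_comm rfl rfl

theorem norm_bitMatching_le_one (i : Fin n) : ‖bitMatching t n i‖ ≤ 1 := by
  have hH : (bitMatching t n i)ᴴ = bitMatching t n i := by
    rw [conjTranspose, bitMatching_transpose]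
    ext x y
    by_cases h : y.1 = flipBit i x.1 <;> simp [bitMatching, h]
  -- The square of a matching is the diagonal projector onto the matched vertices.
  have hsq : (bitMatching t n i)ᴴ * bitMatching t n i
      = diagonal fun x => if flipBit i x.1 ∈ thresholdInputs t n then 1 else 0 := by
    rw [hH]
    ext x y
    rw [mul_apply]
    simp only [bitMatching, of_apply, ite_mul, one_mul, zero_mul]
    by_cases hx : flipBit i x.1 ∈ thresholdInputs t n
    · rw [Finset.sum_eq_single ⟨_, hx⟩ (fun z _ hz => if_neg fun h => hz (Subtype.ext h))
        (by simp)]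
      by_cases hxy : x = y
      · subst hxy; simp [flipBit_flipBit, hx]
      · have : y.1 ≠ x.1 := fun h => hxy (Subtype.ext h.symm)
        simp [flipBit_flipBit, hxy, this]
    · rw [Finset.sum_eq_zero fun z _ => if_neg fun h : z.1 = flipBit i x.1 => hx (h ▸ z.2)]
      by_cases hxy : x = y
      · subst hxy; simp [hx]
      · simp [hxy]
  have h1 : ‖bitMatching t n i‖ * ‖bitMatching t n i‖ ≤ 1 := by
    rw [← l2_opNorm_conjTranspose_mul_self, hsq, l2_opNorm_diagonal,
      pi_norm_le_iff_of_nonneg zero_le_one]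
    intro x
    split_ifs <;> simp
  nlinarith [norm_nonneg (bitMatching t n i)]

/-- Flipping a bit of an input moves it to the other layer, hence changes the output. -/
theorem bitMatching_mul_outputSign (i : Fin n) :
    bitMatching t n i * outputSign (threshold t n)
      = -(outputSign (threshold t n) * bitMatching t n i) := by
  ext x y
  rw [outputSign, mul_diagonal, neg_apply, diagonal_mul, bitMatching, of_apply]
  split_ifs with h h1 h2 h2 <;> try simp
  all_goals
    rw [threshold_eq_zero_iff] at h1 h2
    rw [h] at h1
    have hx := mem_thresholdInputs.1 x.2
    have hy := mem_thresholdInputs.1 y.2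
    rw [h] at hy
    exfalso
    rcases fin_two_cases (x.1 i) with h0 | h0
    · have := weight_flipBit_of_eq_zero h0
      omega
    · have := weight_flipBit_of_eq_one h0
      omega

theorem queryMatrix_zero (X : Finset (Fin n → Fin 2)) (i : Fin n) : queryMatrix X i 0 = 1 := by
  simp [queryMatrix]

theorem queryMatrix_one (X : Finset (Fin n → Fin 2)) (i : Fin n) :
    queryMatrix X i 1 = diagonal fun x => if x.1 i = 0 then 1 else -1 := by
  rw [queryMatrix]
  congr 1
  ext x
  rcases fin_two_cases (x.1 i) with h | h
  · simp [h]
  · have : (2 * (Real.pi : ℂ) * Complex.I / 2) = Real.pi * Complex.I := by ring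
    simp [h, this]

theorem queried_zero {X : Finset (Fin n → Fin 2)} (A : Matrix X X ℂ) (i : Fin n) :
    queried A i 0 = A := by
  simp [queried, queryMatrix_zero]

theorem queried_one_bitMatching (i j : Fin n) :
    queried (bitMatching t n j) i 1
      = if j = i then -bitMatching t n j else bitMatching t n j := by
  ext x y
  rw [queried, queryMatrix_one, diagonal_conjTranspose, mul_diagonal, diagonal_mul]
  by_cases h : y.1 = flipBit j x.1
  · have hy : y.1 i = if i = j then x.1 j + 1 else x.1 i := by
      rw [h, flipBit, Function.update_apply]
    by_cases hji : j = i
    · subst hji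
      rcases fin_two_cases (x.1 j) with hx | hx <;> simp [bitMatching, h, hx, flipBit]
    · rw [if_neg (Ne.symm hji)] at hy
      rcases fin_two_cases (x.1 i) with hx | hx <;> rw [hx] at hy <;>
        simp [bitMatching, h, hx, hy, hji]
  · by_cases hji : j = i
    · subst hji; simp [bitMatching, h]
    · simp [bitMatching, h, hji]

/-- Querying bit `i` changes the sign of the entries of `flipGraph` that belong to a flip of bit
`i`, and no others. -/
theorem flipGraph_sub_queried_one (i : Fin n) :
    flipGraph t n - queried (flipGraph t n) i 1 = (2 : ℂ) • bitMatching t n i := by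
  have h : queried (flipGraph t n) i 1 = ∑ j, queried (bitMatching t n j) i 1 := by
    simp only [queried, flipGraph, Finset.mul_sum, Finset.sum_mul]
  rw [h, flipGraph, ← Finset.sum_sub_distrib, Finset.sum_eq_single i _ (by simp)]
  · rw [queried_one_bitMatching, if_pos rfl, sub_neg_eq_add, two_smul]
  · intro j _ hj
    rw [queried_one_bitMatching, if_neg hj, sub_self]

theorem norm_flipGraph_sub_queried_le (i : Fin n) (p : Fin 2) :
    ‖flipGraph t n - queried (flipGraph t n) i p‖ ≤ 2 := by
  rcases fin_two_cases p with rfl | rfl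
  · simp [queried_zero]
  · rw [flipGraph_sub_queried_one, norm_smul]
    have := norm_bitMatching_le_one (t := t) i
    simpa using this

/-- The top eigenvector of `flipGraph`: it is constant on each of the two layers, with equal
squared norm on both. -/
noncomputable def layerVec (t n : ℕ) (x : Fin n → Fin 2) : ℝ :=
  if weight x = t then √t else √(n + 1 - t)

theorem sum_bitMatching_mul_layerVec (x : thresholdInputs t n) (i : Fin n) :
    ∑ y : thresholdInputs t n, (if y.1 = flipBit i x.1 then (1 : ℝ) else 0) * layerVec t n y.1
      = if weight x.1 = t then (x.1 i : ℝ) * √(n + 1 - t) else (1 - (x.1 i : ℝ)) * √t := by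
  have hx := mem_thresholdInputs.1 x.2
  have h1 : ∑ y : thresholdInputs t n,
        (if y.1 = flipBit i x.1 then (1 : ℝ) else 0) * layerVec t n y.1
      = if flipBit i x.1 ∈ thresholdInputs t n then layerVec t n (flipBit i x.1) else 0 := by
    split_ifs with h
    · rw [Finset.sum_eq_single ⟨_, h⟩ (fun z _ hz => by
        rw [if_neg fun h => hz (Subtype.ext h), zero_mul]) (by simp)]
      simp
    · exact Finset.sum_eq_zero fun z _ => by
        rw [if_neg fun h' : z.1 = flipBit i x.1 => h (h' ▸ z.2), zero_mul]
  rw [h1]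
  simp only [mem_thresholdInputs, layerVec]
  rcases fin_two_cases (x.1 i) with h0 | h0
  · have h2 := weight_flipBit_of_eq_zero h0
    rw [h2, h0]
    split_ifs <;> first | (exfalso; omega) | simp
  · have h2 := weight_flipBit_of_eq_one h0
    rw [h0]
    split_ifs <;> first | (exfalso; omega) | simp

/-- An input of weight `t` has `t` neighbours and one of weight `t - 1` has `n + 1 - t`. -/
theorem sum_flipGraph_mul_layerVec (htn : t ≤ n) (x : thresholdInputs t n) :
    ∑ y : thresholdInputs t n, (∑ i, if y.1 = flipBit i x.1 then (1 : ℝ) else 0) * layerVec t n y.1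
      = √(t * (n + 1 - t)) * layerVec t n x.1 := by
  have hx := mem_thresholdInputs.1 x.2
  have ht : (t : ℝ) ≤ n := by exact_mod_cast htn
  have ht0 : (0 : ℝ) ≤ t := by positivity
  have hnt : (0 : ℝ) ≤ n + 1 - t := by linarith
  have hw : ∑ i, (x.1 i : ℝ) = weight x.1 := by
    simp [weight]
  simp only [Finset.sum_mul]
  rw [Finset.sum_comm]
  simp only [sum_bitMatching_mul_layerVec]
  rw [layerVec, Real.sqrt_mul ht0]
  split_ifs with h
  · rw [← Finset.sum_mul, hw, h, mul_right_comm, Real.mul_self_sqrt ht0]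
  · have h' : (weight x.1 : ℝ) = t - 1 := by
      rw [eq_sub_iff_add_eq]; exact_mod_cast hx.resolve_right h
    rw [← Finset.sum_mul, Finset.sum_sub_distrib, hw, h', mul_assoc, Real.mul_self_sqrt hnt]
    simp
    ring

theorem layerVec_pos (ht : 1 ≤ t) (htn : t ≤ n) (x : Fin n → Fin 2) : 0 < layerVec t n x := by
  have h1 : (1 : ℝ) ≤ t := by exact_mod_cast ht
  have h2 : (t : ℝ) ≤ n := by exact_mod_cast htn
  rw [layerVec]
  split_ifs <;> exact Real.sqrt_pos.2 (by linarith)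

theorem flipGraph_apply (x y : thresholdInputs t n) :
    flipGraph t n x y = ((∑ i, if y.1 = flipBit i x.1 then (1 : ℝ) else 0 : ℝ) : ℂ) := by
  simp only [flipGraph, Matrix.sum_apply, bitMatching, of_apply]
  rw [Complex.ofReal_sum]
  exact Finset.sum_congr rfl fun i _ => by split_ifs <;> simp

theorem flipGraph_mulVec_layerVec (htn : t ≤ n) :
    (flipGraph t n *ᵥ fun x => (layerVec t n x.1 : ℂ))
      = ((√(t * (n + 1 - t)) : ℝ) : ℂ) • fun x => (layerVec t n x.1 : ℂ) := by
  ext x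
  simp only [mulVec, dotProduct, flipGraph_apply, Pi.smul_apply, smul_eq_mul]
  exact_mod_cast sum_flipGraph_mul_layerVec htn x

theorem nonempty_thresholdInputs (htn : t ≤ n) : Nonempty (thresholdInputs t n) := by
  refine ⟨⟨fun i => if i.1 < t then 1 else 0, mem_thresholdInputs.2 (Or.inr ?_)⟩⟩
  have : ∀ i : Fin n, (((if i.1 < t then 1 else 0 : Fin 2)) : ℕ) = if i.1 < t then 1 else 0 :=
    fun i => by split_ifs <;> rfl
  simp only [weight, this, Finset.sum_boole, Nat.cast_id]
  rw [Fin.card_filter_val_lt, min_eq_right htn]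

/-- The matchings sum to `flipGraph`, whose quadratic form at its top eigenvector is positive. -/
theorem exists_re_dotProduct_bitMatching_pos (ht : 1 ≤ t) (htn : t ≤ n) :
    ∃ i, 0 < (star (fun x : thresholdInputs t n => (layerVec t n x.1 : ℂ)) ⬝ᵥ
      (bitMatching t n i *ᵥ fun x => (layerVec t n x.1 : ℂ))).re := by
  set v : thresholdInputs t n → ℂ := fun x => (layerVec t n x.1 : ℂ) with hv
  by_contra! h
  have := nonempty_thresholdInputs htn
  have h1 : (1 : ℝ) ≤ t := by exact_mod_cast ht
  have h2 : (t : ℝ) ≤ n := by exact_mod_cast htn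
  have hsum : ∑ i, (star v ⬝ᵥ (bitMatching t n i *ᵥ v)).re
      = √(t * (n + 1 - t)) * ∑ x : thresholdInputs t n, layerVec t n x.1 ^ 2 := by
    rw [← Complex.re_sum, ← dotProduct_sum, ← sum_mulVec, ← flipGraph,
      flipGraph_mulVec_layerVec htn, dotProduct_smul, smul_eq_mul, Complex.re_ofReal_mul]
    congr 1
    simp only [dotProduct, hv, Pi.star_apply, RCLike.star_def, Complex.conj_ofReal]
    rw [Complex.re_sum]
    refine Finset.sum_congr rfl fun x _ => ?_
    rw [← Complex.ofReal_mul, Complex.ofReal_re, sq]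
  have hpos : 0 < √(t * (n + 1 - t)) * ∑ x : thresholdInputs t n, layerVec t n x.1 ^ 2 :=
    mul_pos (Real.sqrt_pos.2 (mul_pos (by linarith) (by linarith)))
      (Finset.sum_pos (fun x _ => pow_pos (layerVec_pos ht htn _) 2) Finset.univ_nonempty)
  have hneg := Finset.sum_nonpos fun i (_ : i ∈ Finset.univ) => h i
  linarith

theorem le_MADV_threshold (ht : 1 ≤ t) (htn : t ≤ n) {ζ : ℝ} (hζ : 0 < ζ) :
    ((ζ ^ 2 * √(t * (n + 1 - t)) / (Real.exp 1 * 2) : ℝ) : EReal)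
      ≤ MADV (threshold t n) (1 / 2) (4 * ζ) := by
  have h1 : (1 : ℝ) ≤ t := by exact_mod_cast ht
  have h2 : (t : ℝ) ≤ n := by exact_mod_cast htn
  obtain ⟨i, hi⟩ := exists_re_dotProduct_bitMatching_pos ht htn
  refine le_MADV_of_top_eigenvector (A := flipGraph t n)
    (v := fun x => (layerVec t n x.1 : ℂ))
    (Real.sqrt_pos.2 (mul_pos (by linarith) (by linarith))) two_pos ?_ ?_ ?_
    (flipGraph_mulVec_layerVec htn) norm_flipGraph_sub_queried_le ⟨i, 1, ?_⟩ hζ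
  · refine posSemidef_smul_one_sub_of_pos_eigenvector (v := fun x => layerVec t n x.1)
      flipGraph_apply (fun x y => ?_) (fun x y => ?_) (fun x => layerVec_pos ht htn _)
      (sum_flipGraph_mul_layerVec htn)
    · exact Finset.sum_congr rfl fun i _ => if_congr eq_flipBit_comm rfl rfl
    · exact Finset.sum_nonneg fun i _ => by split_ifs <;> norm_num
  · simp only [flipGraph, Finset.sum_mul, Finset.mul_sum, bitMatching_mul_outputSign,
      Finset.sum_neg_distrib]
  · obtain ⟨x⟩ := nonempty_thresholdInputs htn
    intro h
    have := congrFun h x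
    simp only [Pi.zero_apply, Complex.ofReal_eq_zero] at this
    exact (layerVec_pos ht htn x.1).ne' this
  · rw [flipGraph_sub_queried_one, smul_mulVec, dotProduct_smul, smul_eq_mul]
    have : ((2 : ℝ) : ℂ) = 2 := by norm_num
    rw [← this, Complex.re_ofReal_mul]
    positivity

end Threshold

end QuantumAdversary

theorem mainTheorem5 :
    ∃ c : ℝ, 0 < c ∧ ∀ (n t : ℕ) (ζ : ℝ), 1 ≤ t → 2 * t ≤ n → 0 < ζ →
      ((c * ζ ^ 2 * Real.sqrt ((t : ℝ) * (n : ℝ)) : ℝ) : EReal) ≤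
        QuantumAdversary.MADV (QuantumAdversary.threshold t n) (1 / 2) (4 * ζ) := by
  refine ⟨1 / (4 * Real.exp 1), by positivity, fun n t ζ ht htn hζ => ?_⟩
  refine le_trans ?_ (QuantumAdversary.le_MADV_threshold ht (by omega) hζ)
  rw [EReal.coe_le_coe_iff]
  have h2 : 2 * (t : ℝ) ≤ n := by exact_mod_cast htn
  have ht0 : (0 : ℝ) ≤ t := by positivity
  -- Because `t ≤ n / 2`, the number `n + 1 - t` is at least `n / 4`; the factor `4` is a square.
  have hsqrt : √((t : ℝ) * n) ≤ 2 * √(t * (n + 1 - t)) := by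
    rw [show (2 : ℝ) = √4 by rw [show (4 : ℝ) = 2 ^ 2 by norm_num]; simp,
      ← Real.sqrt_mul (by norm_num)]
    exact Real.sqrt_le_sqrt (by nlinarith)
  calc 1 / (4 * Real.exp 1) * ζ ^ 2 * √((t : ℝ) * n)
      ≤ 1 / (4 * Real.exp 1) * ζ ^ 2 * (2 * √(t * (n + 1 - t))) := by gcongr
    _ = _ := by field_simp; ring
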